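/- \textbf{Theorem (oracle inequality for joint mean regression).} For all constants $C,c>0$ there is a constant $C_1>0$, depending only on $C$ and $c$, such that the following holds for every $n\ge 1$ and all dimensions $D_X,D_Y$. Let $\mu^*=\mu^*_X\,\mu^*_{Y|X}$ be a probability distribution on $\mathbb R^{D_X}\times\mathbb R^{D_Y}$ with marginal $\mu^*_X$ and conditional distributions $\mu^*_{Y|x}$, carried by a set $\mathcal M$ (that is, $(X,Y)\in\mathcal M$ almost surely), and let $(X_1,Y_1),\dots,(X_n,Y_n)$ be i.i.d. samples from $\mu^*$. Let $\Lambda$ be a countable set and let $\psi_\lambda:\mathbb R^{D_Y}\to\mathbb R$ $(\lambda\in\Lambda)$ be measurable functions such that, for each $\lambda$, $\psi_\lambda$ is $\mu^*_{Y|x}$-integrable for $\mu_X^*$-almost every $x$, and such that $\sum_{\lambda}\psi_\lambda(Y)^2<\infty$ almost surely. Let $\mathcal S$ be a class of functions $S:\Lambda\times\mathbb R^{D_X}\to\mathbb R$, measurable in the second argument. Put $$\ell(x,y,S)=\sum_{\lambda\in\Lambda}\bigl(S(\lambda,x)^2-2\psi_\lambda(y)S(\lambda,x)\bigr),\qquad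 d_n(S,S')=\sqrt{\frac1n\sum_{i=1}^n\bigl(\ell(X_i,Y_i,S)-\ell(X_i,Y_i,S')\bigr)^2},$$ and let $\mathbf N(\mathcal S,d_n,\varepsilon)$ be the least number of closed $d_n$-balls of radius $\varepsilon$ with centres in $\mathcal S$ that cover $\mathcal S$. Assume: \begin{enumerate} \item for every $S\in\mathcal S$, $\displaystyle\sup_{(x,y)\in\mathcal M}\sum_{\lambda\in\Lambda}\bigl(S(\lambda,x)^2+|\psi_\lambda(y)S(\lambda,x)|\bigr)\le C$; \item for all $S,S'\in\mathcal S$, $\displaystyle\mathbb E_{\mu^*}\bigl[(\ell(X,Y,S)-\ell(X,Y,S'))^2\bigr]\le C\,\mathbb E_{\mu^*_X}\Bigl[\sum_{\lambda\in\Lambda}\bigl(S(\lambda,X)-S'(\lambda,X)\bigr)^2\Bigr]$; \item for some real numbers $W_n,T_n>1$ it holds, almost surely, that for all $0<\varepsilon\le\sup_{S,S'\in\mathcal S}d_n(S,S')$, $\displaystyle\mathbf N(\mathcal S,d_n,\varepsilon)\le (T_n/\varepsilon)^{W_n}$. \end{enumerate} Let $\widehat S$ be an $\mathcal S$-valued estimator,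 that is, a function of the data with values in $\mathcal S$ such that $\widehat S(\lambda,x)$ is, for each $\lambda$, jointly measurable in the data and $x$; and suppose that almost surely $$\widehat S\in\operatorname*{arg\,min}_{S\in\mathcal S}\ \frac1n\sum_{i=1}^n\sum_{\lambda\in\Lambda}\bigl(S(\lambda,X_i)-\psi_\lambda(Y_i)\bigr)^2 .$$ Then, with probability at least $1-n^{-c}$, $$\mathbb E_{\mu^*_X}\Bigl[\sum_{\lambda\in\Lambda}\bigl(\widehat S(\lambda,X)-\mathbb E_{\mu^*_{Y|X}}[\psi_\lambda(Y)]\bigr)^2\Bigr]\le C_1\frac{W_n(\log n+\log T_n)}{n}+C_1\inf_{S\in\mathcal S}\mathbb E_{\mu^*_X}\Bigl[\sum_{\lambda\in\Lambda}\bigl(S(\lambda,X)-\mathbb E_{\mu^*_{Y|X}}[\psi_\lambda(Y)]\bigr)^2\Bigr],$$ where the expectation $\mathbb E_{\mu_X^*}$ on the left is over $X$ only, with $\widehat S$ held fixed, and both sides take values in $[0,\infty]$. -/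

import Mathlib

open MeasureTheory ProbabilityTheory
open scoped ENNReal NNReal

namespace JointRegression

/-- The loss `ℓ(x, y, S) = ∑_λ (S(λ, x)² - 2 ψ_λ(y) S(λ, x))`. -/
noncomputable def loss {Λ E F : Type*} (ψ : Λ → F → ℝ) (z : E × F) (S : Λ → E → ℝ) : ℝ :=
  ∑' l, (S l z.1 ^ 2 - 2 * ψ l z.2 * S l z.1)

/-- The least squares criterion `(1/n) ∑_i ∑_λ (S(λ, X_i) - ψ_λ(Y_i))²`, with values in
`[0, ∞]`, so that no convergence has to be presupposed. -/
noncomputable def empRisk {Λ E F : Type*} {n : ℕ} (ψ : Λ → F → ℝ) (z : Fin n → E × F)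
    (S : Λ → E → ℝ) : ℝ≥0∞ :=
  (n : ℝ≥0∞)⁻¹ * ∑ i, ∑' l, ENNReal.ofReal ((S l (z i).1 - ψ l (z i).2) ^ 2)

/-- The empirical distance
`d_n(S, S') = √((1/n) ∑_i (ℓ(X_i, Y_i, S) - ℓ(X_i, Y_i, S'))²)`. -/
noncomputable def empDist {Λ E F : Type*} {n : ℕ} (ψ : Λ → F → ℝ) (z : Fin n → E × F)
    (S S' : Λ → E → ℝ) : ℝ :=
  √((1 / (n : ℝ)) * ∑ i, (loss ψ (z i) S - loss ψ (z i) S') ^ 2)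

theorem empDist_eq_norm {Λ E F : Type*} {n : ℕ} (ψ : Λ → F → ℝ) (z : Fin n → E × F)
    (S S' : Λ → E → ℝ) :
    empDist ψ z S S' = √(1 / (n : ℝ)) *
      dist (WithLp.toLp 2 fun i => loss ψ (z i) S : EuclideanSpace ℝ (Fin n))
        (WithLp.toLp 2 fun i => loss ψ (z i) S') := by
  rw [empDist, Real.sqrt_mul (by positivity), EuclideanSpace.dist_eq]
  simp [Real.dist_eq, sq_abs]

/-- The pseudometric space of candidate functions with `d_n` as its distance. -/
@[reducible] noncomputable def empPseudoMetric {Λ E F : Type*} {n : ℕ} (ψ : Λ → F → ℝ)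
    (z : Fin n → E × F) : PseudoMetricSpace (Λ → E → ℝ) where
  dist := empDist ψ z
  dist_self S := by rw [empDist_eq_norm, dist_self, mul_zero]
  dist_comm S S' := by rw [empDist_eq_norm, empDist_eq_norm, dist_comm]
  dist_triangle S S' S'' := by
    rw [empDist_eq_norm, empDist_eq_norm, empDist_eq_norm, ← mul_add]
    exact mul_le_mul_of_nonneg_left (dist_triangle _ _ _) (Real.sqrt_nonneg _)

/-- The covering number `N(𝒮, d_n, ε)`: the least number of closed `d_n`-balls of radius `ε`
with centres in `𝒮` that cover `𝒮`. -/
noncomputable def empCoveringNumber {Λ E F : Type*} {n : ℕ} (ψ : Λ → F → ℝ)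
    (z : Fin n → E × F) (𝒮 : Set (Λ → E → ℝ)) (ε : ℝ≥0) : ℕ∞ :=
  letI := empPseudoMetric ψ z
  Metric.coveringNumber ε 𝒮

/-- The squared distance `E_{μ_X}[∑_λ (S(λ, X) - S'(λ, X))²]`, with values in `[0, ∞]`. -/
noncomputable def sqDist {Λ E : Type*} [MeasurableSpace E] (μX : Measure E)
    (S S' : Λ → E → ℝ) : ℝ≥0∞ :=
  ∫⁻ x, ∑' l, ENNReal.ofReal ((S l x - S' l x) ^ 2) ∂μX

/-- The regression functions `(λ, x) ↦ E_{μ_{Y|x}}[ψ_λ(Y)]`. -/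
noncomputable def condMean {Λ E F : Type*} [MeasurableSpace E] [MeasurableSpace F]
    (κ : Kernel E F) (ψ : Λ → F → ℝ) : Λ → E → ℝ :=
  fun l x => ∫ y, ψ l y ∂(κ x)

end JointRegression

/-! Write `m` for the regression function and `D(S)` for the squared distance from `S` to `m`.
Expanding the square and integrating out `Y` shows that the risk `E ℓ(X, Y, S)` equals `D(S)` minus
a constant (`toReal_sqDist_condMean`). Fix a near-minimiser `S₀` of `D` and put `h = ℓ(·, Ŝ) - ℓ(·,
S₀)`. Then `E h = D(Ŝ) - D(S₀)`, the minimising property gives `∑ h(Z_i) ≤ 0`, and assumption (2)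
gives `E h² ≤ 2C (D(Ŝ) + D(S₀))`. The variance is thus controlled by the quantity to be bounded,
which is what yields a rate of order `1/n`.

The deviation is measured with a quadratic offset: for a suitable transform `g` of `h` and `b =
1/(32C)`, the quantity `n ∫ (g - b g²) - ∑ (g(Z_i) + b g(Z_i)²)` has a bounded exponential moment
(`lintegral_exp_deviation_le`). Jensen's inequality replaces the integral by a ghost sample, random
exchanges of the two samples introduce signs, and the offset absorbs the sub-Gaussian factor of each
sign. A cover at scale of order `1/n` reduces the class to finitely many vectors, so neither
chaining nor a supremum over the class is needed: the estimator itself is inserted, as a measurable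
function of the data.

The transform `offsetClip` is `h - h²/(16C)`, truncated so as to be bounded everywhere. It puts the
empirical part below `∑ h(Z_i) ≤ 0` and the population part above `E h - E h²/(8C)`, which is at
least `(3/4) D(Ŝ) - (5/4) D(S₀)`. A Chernoff bound at level `c log n` finishes the proof. -/

namespace JointRegression

/-! ### Exponential moments of offset Rademacher sums -/

/-- The Rademacher sign `±1` attached to a Boolean. -/
def rademacher (s : Bool) : ℝ := if s then 1 else -1

/-- The sum factorises over coordinates, and each factor is `2 cosh(b v_i) exp(-(b v_i)²/2) ≤ 2`:
the offset cancels the sub-Gaussian growth exactly. -/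
theorem sum_exp_rademacher_le {n : ℕ} (b : ℝ) (v : Fin n → ℝ) :
    ∑ σ : Fin n → Bool, Real.exp (b * ∑ i, (rademacher (σ i) * v i - b / 2 * v i ^ 2)) ≤ 2 ^ n := by
  have h (σ : Fin n → Bool) :
      Real.exp (b * ∑ i, (rademacher (σ i) * v i - b / 2 * v i ^ 2)) =
        ∏ i, Real.exp (b * (rademacher (σ i) * v i - b / 2 * v i ^ 2)) := by
    rw [Finset.mul_sum, Real.exp_sum]
  simp_rw [h]
  rw [← Fintype.prod_sum (fun i s => Real.exp (b * (rademacher s * v i - b / 2 * v i ^ 2)))]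
  refine (Finset.prod_le_prod (fun i _ => Finset.sum_nonneg fun s _ => (Real.exp_pos _).le)
    (g := fun _ => (2 : ℝ)) fun i _ => ?_).trans (by simp)
  have h1 : b * (1 * v i - b / 2 * v i ^ 2) = b * v i + -((b * v i) ^ 2 / 2) := by ring
  have h2 : b * (-1 * v i - b / 2 * v i ^ 2) = -(b * v i) + -((b * v i) ^ 2 / 2) := by ring
  have h3 := Real.cosh_le_exp_half_sq (b * v i)
  rw [Real.cosh_eq] at h3
  simp only [Fintype.sum_bool, rademacher, if_true, Bool.false_eq_true, if_false]
  rw [h1, h2, Real.exp_add, Real.exp_add, ← add_mul, Real.exp_neg ((b * v i) ^ 2 / 2),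
    ← div_eq_mul_inv, div_le_iff₀ (Real.exp_pos _)]
  linarith

/-- The vector `u` may depend on the signs, as the estimator will after the samples are exchanged.
Replacing it by a nearby point of the fixed set `t` and summing over all of `t` removes this
dependence. The replacement costs half of the offset and the last exponential factor. -/
theorem sum_exp_rademacher_cover_le {n : ℕ} {b ε : ℝ} (hb : 0 ≤ b) (hε : 0 ≤ ε)
    (t : Finset (Fin n → ℝ)) (u : (Fin n → Bool) → Fin n → ℝ)
    (hu : ∀ σ, ∃ v ∈ t, ∑ i, (u σ i - v i) ^ 2 ≤ n * ε ^ 2) :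
    ∑ σ : Fin n → Bool, Real.exp (b * ∑ i, (rademacher (σ i) * u σ i - b * u σ i ^ 2)) ≤
      t.card * 2 ^ n * Real.exp (b * n * (ε + b * ε ^ 2)) := by
  have key (σ : Fin n → Bool) :
      Real.exp (b * ∑ i, (rademacher (σ i) * u σ i - b * u σ i ^ 2)) ≤
        ∑ v ∈ t, Real.exp (b * ∑ i, (rademacher (σ i) * v i - b / 2 * v i ^ 2)) *
          Real.exp (b * n * (ε + b * ε ^ 2)) := by
    obtain ⟨v, hv, hd⟩ := hu σ
    refine le_trans ?_ (Finset.single_le_sum (fun w _ => by positivity) hv)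
    rw [← Real.exp_add, Real.exp_le_exp, mul_assoc b, ← mul_add]
    refine mul_le_mul_of_nonneg_left ?_ hb
    -- Cauchy–Schwarz: the sign vector has norm `√n`, the difference at most `√n ε`.
    have h1 : ∑ i, rademacher (σ i) * (u σ i - v i) ≤ n * ε := by
      refine abs_le_of_sq_le_sq' ?_ (by positivity) |>.2
      refine (Finset.sum_mul_sq_le_sq_mul_sq _ _ _).trans ?_
      have : ∑ i, rademacher (σ i) ^ 2 = n := by
        rw [Finset.sum_congr rfl (g := fun _ => (1 : ℝ)) fun i _ => by
          rw [rademacher]; split_ifs <;> norm_num]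
        simp
      rw [this]
      nlinarith [mul_le_mul_of_nonneg_left hd (Nat.cast_nonneg (α := ℝ) n)]
    -- Termwise this is `v²/2 ≤ u² + (u - v)²`, the difference being `(2u - v)²/2`.
    have h2 : ∑ i, (rademacher (σ i) * u σ i - b * u σ i ^ 2) ≤
        ∑ i, ((rademacher (σ i) * v i - b / 2 * v i ^ 2) +
          (rademacher (σ i) * (u σ i - v i) + b * (u σ i - v i) ^ 2)) := by
      refine Finset.sum_le_sum fun i _ => ?_
      nlinarith [mul_nonneg hb (sq_nonneg (2 * u σ i - v i))]
    rw [Finset.sum_add_distrib, Finset.sum_add_distrib, ← Finset.mul_sum] at h2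
    nlinarith [mul_le_mul_of_nonneg_left hd hb]
  refine (Finset.sum_le_sum fun σ _ => key σ).trans ?_
  rw [Finset.sum_comm]
  simp_rw [← Finset.sum_mul]
  refine mul_le_mul_of_nonneg_right ?_ (Real.exp_pos _).le
  refine (Finset.sum_le_sum fun v _ => sum_exp_rademacher_le b v).trans ?_
  simp

/-- Each half of the double sample has its own cover. The bound `exp((x + y)/2) ≤ (exp x + exp y)/2`
decouples the halves, which is why the exponent carries `b / 2`. -/
theorem sum_exp_rademacher_pair_le {n : ℕ} {b ε N : ℝ} (hb : 0 ≤ b) (hε : 0 ≤ ε)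
    (t t' : Finset (Fin n → ℝ)) (ht : (t.card : ℝ) ≤ N) (ht' : (t'.card : ℝ) ≤ N)
    (u u' : (Fin n → Bool) → Fin n → ℝ)
    (hu : ∀ σ, ∃ v ∈ t, ∑ i, (u σ i - v i) ^ 2 ≤ n * ε ^ 2)
    (hu' : ∀ σ, ∃ v ∈ t', ∑ i, (u' σ i - v i) ^ 2 ≤ n * ε ^ 2) :
    ∑ σ : Fin n → Bool, Real.exp (b / 2 * ∑ i,
        (rademacher (σ i) * (u' σ i - u σ i) - b * (u σ i ^ 2 + u' σ i ^ 2))) ≤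
      2 ^ n * (N * Real.exp (b * n * (ε + b * ε ^ 2))) := by
  classical
  have h1 := sum_exp_rademacher_cover_le hb hε t' u' hu'
  have h2 := sum_exp_rademacher_cover_le hb hε (t.image fun v => -v) (fun σ => -u σ) (fun σ => by
    obtain ⟨v, hv, h⟩ := hu σ
    refine ⟨-v, Finset.mem_image_of_mem _ hv, le_of_eq_of_le (Finset.sum_congr rfl fun i _ => ?_) h⟩
    simp only [Pi.neg_apply]
    ring)
  have hc : (((t.image fun v => -v).card : ℕ) : ℝ) ≤ N :=
    le_trans (Nat.cast_le.2 Finset.card_image_le) ht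
  have h3 (σ : Fin n → Bool) : Real.exp (b / 2 * ∑ i,
      (rademacher (σ i) * (u' σ i - u σ i) - b * (u σ i ^ 2 + u' σ i ^ 2))) ≤
      (Real.exp (b * ∑ i, (rademacher (σ i) * u' σ i - b * u' σ i ^ 2)) +
        Real.exp (b * ∑ i, (rademacher (σ i) * (-u σ) i - b * (-u σ) i ^ 2))) / 2 := by
    set x := b * ∑ i, (rademacher (σ i) * u' σ i - b * u' σ i ^ 2)
    set y := b * ∑ i, (rademacher (σ i) * (-u σ) i - b * (-u σ) i ^ 2)
    have : b / 2 * ∑ i, (rademacher (σ i) * (u' σ i - u σ i) - b * (u σ i ^ 2 + u' σ i ^ 2)) =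
        x / 2 + y / 2 := by
      simp only [x, y]
      rw [← add_div, ← mul_add, ← Finset.sum_add_distrib, mul_div_right_comm]
      congr 1
      refine Finset.sum_congr rfl fun i _ => ?_
      simp only [Pi.neg_apply]
      ring
    rw [this, Real.exp_add]
    have hx : Real.exp x = Real.exp (x / 2) ^ 2 := by
      rw [← Real.exp_nat_mul]; congr 1; push_cast; ring
    have hy : Real.exp y = Real.exp (y / 2) ^ 2 := by
      rw [← Real.exp_nat_mul]; congr 1; push_cast; ring
    rw [hx, hy]
    nlinarith [sq_nonneg (Real.exp (x / 2) - Real.exp (y / 2))]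
  refine (Finset.sum_le_sum fun σ _ => h3 σ).trans ?_
  rw [← Finset.sum_div, Finset.sum_add_distrib]
  have e := Real.exp_pos (b * n * (ε + b * ε ^ 2))
  have p : (0 : ℝ) < 2 ^ n := by positivity
  have q := mul_pos p e
  nlinarith [mul_le_mul_of_nonneg_right ht' q.le, mul_le_mul_of_nonneg_right hc q.le]

/-! ### Ghost sample and symmetrisation -/

/-- Exchange the coordinates `i` with `σ i = false` of the two halves of a double sample. -/
def swapSample {G : Type*} {n : ℕ} (σ : Fin n → Bool) (w : (Fin n → G) × (Fin n → G)) :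
    (Fin n → G) × (Fin n → G) :=
  (fun i => if σ i then w.1 i else w.2 i, fun i => if σ i then w.2 i else w.1 i)

theorem measurePreserving_swapSample {G : Type*} [MeasurableSpace G] (ν : Measure G)
    [IsProbabilityMeasure ν] {n : ℕ} (σ : Fin n → Bool) :
    MeasurePreserving (swapSample σ)
      ((Measure.pi fun _ : Fin n => ν).prod (Measure.pi fun _ : Fin n => ν))
      ((Measure.pi fun _ : Fin n => ν).prod (Measure.pi fun _ : Fin n => ν)) := by
  have e := measurePreserving_arrowProdEquivProdArrow G G (Fin n) (fun _ => ν) (fun _ => ν)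
  have h : MeasurePreserving (fun (a : Fin n → G × G) i => (if σ i then id else Prod.swap) (a i))
      (Measure.pi fun _ => ν.prod ν) (Measure.pi fun _ => ν.prod ν) := by
    refine measurePreserving_pi _ _ (f := fun i => (if σ i then id else Prod.swap)) fun i => ?_
    split_ifs
    · exact MeasurePreserving.id _
    · exact Measure.measurePreserving_swap
  convert e.comp (h.comp e.symm) using 1
  ext w i
  · by_cases hi : σ i <;> simp [swapSample, MeasurableEquiv.arrowProdEquivProdArrow,
      Equiv.arrowProdEquivProdArrow, hi]
  · by_cases hi : σ i <;> simp [swapSample, MeasurableEquiv.arrowProdEquivProdArrow,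
      Equiv.arrowProdEquivProdArrow, hi]

theorem lintegral_eq_lintegral_sum_swapSample {G : Type*} [MeasurableSpace G] (ν : Measure G)
    [IsProbabilityMeasure ν] {n : ℕ} {F : (Fin n → G) × (Fin n → G) → ℝ≥0∞} (hF : Measurable F) :
    ∫⁻ w, F w ∂((Measure.pi fun _ : Fin n => ν).prod (Measure.pi fun _ : Fin n => ν)) =
      ∫⁻ w, (2 ^ n)⁻¹ * ∑ σ : Fin n → Bool, F (swapSample σ w)
        ∂((Measure.pi fun _ : Fin n => ν).prod (Measure.pi fun _ : Fin n => ν)) := by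
  have hm (σ : Fin n → Bool) := measurePreserving_swapSample ν σ
  have hmF (σ : Fin n → Bool) : Measurable fun w => F (swapSample σ w) :=
    hF.comp (hm σ).measurable
  rw [lintegral_const_mul _ (Finset.measurable_sum _ fun σ _ => hmF σ),
    lintegral_finsetSum _ fun σ _ => hmF σ]
  simp_rw [fun σ => (hm σ).lintegral_comp hF]
  simp only [Finset.sum_const, Finset.card_univ, Fintype.card_pi, Fintype.card_bool,
    Finset.prod_const, Fintype.card_fin, nsmul_eq_mul]
  rw [← mul_assoc]
  push_cast
  rw [ENNReal.inv_mul_cancel (by positivity) (by finiteness), one_mul]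

theorem integrable_of_measurable_of_abs_le {G : Type*} [MeasurableSpace G] {μ : Measure G}
    [IsFiniteMeasure μ] {f : G → ℝ} (hf : Measurable f) {B : ℝ} (hB : ∀ x, |f x| ≤ B) :
    Integrable f μ :=
  Integrable.of_bound hf.aestronglyMeasurable B (ae_of_all _ hB)

/-- Jensen's inequality for the exponential of a sum over an independent sample. -/
theorem ofReal_exp_mul_integral_le {G : Type*} [MeasurableSpace G] (ν : Measure G)
    [IsProbabilityMeasure ν] {n : ℕ} {f : G → ℝ} (hf : Measurable f) {B : ℝ}
    (hB : ∀ x, |f x| ≤ B) (a : ℝ) :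
    ENNReal.ofReal (Real.exp (a + n * ∫ x, f x ∂ν)) ≤
      ∫⁻ w, ENNReal.ofReal (Real.exp (a + ∑ i, f (w i))) ∂(Measure.pi fun _ : Fin n => ν) := by
  set π := Measure.pi fun _ : Fin n => ν
  have hfi (i : Fin n) : Integrable (fun w : Fin n → G => f (w i)) π :=
    integrable_of_measurable_of_abs_le (hf.comp (measurable_pi_apply i)) fun w => hB (w i)
  have hint : ∫ w, (a + ∑ i, f (w i)) ∂π = a + n * ∫ x, f x ∂ν := by
    rw [integral_add (integrable_const _) (integrable_finsetSum _ fun i _ => hfi i),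
      integral_finsetSum _ fun i _ => hfi i]
    have (i : Fin n) : ∫ w, f (w i) ∂π = ∫ x, f x ∂ν := by
      have e := measurePreserving_eval (fun _ : Fin n => ν) i
      rw [← e.map_eq, integral_map e.measurable.aemeasurable (hf.aestronglyMeasurable)]
    simp [this]
  have hm : Measurable fun w : Fin n → G => a + ∑ i, f (w i) :=
    measurable_const.add (Finset.measurable_sum _ fun i _ => hf.comp (measurable_pi_apply i))
  have hle (w : Fin n → G) : |∑ i, f (w i)| ≤ n * B :=
    (Finset.abs_sum_le_sum_abs _ _).trans ((Finset.sum_le_sum fun i _ => hB (w i)).trans (by simp))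
  have hexp : Integrable (Real.exp ∘ fun w : Fin n → G => a + ∑ i, f (w i)) π := by
    refine integrable_of_measurable_of_abs_le (Real.measurable_exp.comp hm)
      (B := Real.exp (a + n * B)) fun w => ?_
    rw [Function.comp_apply, abs_of_pos (Real.exp_pos _), Real.exp_le_exp]
    linarith [le_abs_self (∑ i, f (w i)), hle w]
  have hj := convexOn_exp.map_integral_le (μ := π) (f := fun w : Fin n → G => a + ∑ i, f (w i))
    Real.continuous_exp.continuousOn isClosed_univ (ae_of_all _ fun _ => Set.mem_univ _)
    ((integrable_const _).add (integrable_finsetSum _ fun i _ => hfi i)) hexp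
  rw [hint] at hj
  refine (ENNReal.ofReal_le_ofReal hj).trans_eq ?_
  exact ofReal_integral_eq_lintegral_ofReal hexp (ae_of_all _ fun _ => (Real.exp_pos _).le)

/-- Exponential moment bound for the regularised deviation of a data-dependent member `g z` of a
class that is covered, on almost every sample, by at most `N` balls. -/
theorem lintegral_exp_deviation_le {G Ω : Type*} [MeasurableSpace G] [MeasurableSpace Ω]
    (ν : Measure G) [IsProbabilityMeasure ν] (P : Measure Ω) [IsProbabilityMeasure P] {n : ℕ}
    {Z : Ω → Fin n → G} (hZ : Measurable Z) (hlaw : P.map Z = Measure.pi fun _ => ν)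
    {g : (Fin n → G) → G → ℝ} (hg : Measurable fun p : (Fin n → G) × G => g p.1 p.2)
    {B : ℝ} (hB : ∀ z x, |g z x| ≤ B) {b ε N : ℝ} (hb : 0 ≤ b) (hε : 0 ≤ ε)
    (hcov : ∀ᵐ ω ∂P, ∃ t : Finset (Fin n → ℝ), (t.card : ℝ) ≤ N ∧
      ∀ z, ∃ v ∈ t, ∑ i, (g z (Z ω i) - v i) ^ 2 ≤ n * ε ^ 2) :
    ∫⁻ ω, ENNReal.ofReal (Real.exp (b / 2 *
        (n * ∫ x, (g (Z ω) x - b * g (Z ω) x ^ 2) ∂ν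
          - ∑ i, (g (Z ω) (Z ω i) + b * g (Z ω) (Z ω i) ^ 2)))) ∂P ≤
      ENNReal.ofReal (N * Real.exp (b * n * (ε + b * ε ^ 2))) := by
  have hgz (z : Fin n → G) : Measurable (g z) := hg.comp measurable_prodMk_left
  set π := Measure.pi fun _ : Fin n => ν with hπ
  set F : (Fin n → G) × (Fin n → G) → ℝ≥0∞ := fun w => ENNReal.ofReal (Real.exp (b / 2 *
    ∑ i, (g w.1 (w.2 i) - g w.1 (w.1 i) - b * (g w.1 (w.1 i) ^ 2 + g w.1 (w.2 i) ^ 2)))) with hFdef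
  have hF : Measurable F := by
    have h1 (i : Fin n) : Measurable fun w : (Fin n → G) × (Fin n → G) => g w.1 (w.1 i) :=
      hg.comp (measurable_fst.prodMk ((measurable_pi_apply i).comp measurable_fst))
    have h2 (i : Fin n) : Measurable fun w : (Fin n → G) × (Fin n → G) => g w.1 (w.2 i) :=
      hg.comp (measurable_fst.prodMk ((measurable_pi_apply i).comp measurable_snd))
    refine (Real.measurable_exp.comp (Measurable.const_mul (Finset.measurable_sum _ fun i _ => ?_)
      _)).ennreal_ofReal
    exact ((h2 i).sub (h1 i)).sub ((((h1 i).pow_const 2).add ((h2 i).pow_const 2)).const_mul b)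
  -- With the first sample held fixed, `g z` is a fixed function, so the population term is a mean
  -- over the ghost sample.
  have hjensen (z : Fin n → G) : ENNReal.ofReal (Real.exp (b / 2 *
        (n * ∫ x, (g z x - b * g z x ^ 2) ∂ν - ∑ i, (g z (z i) + b * g z (z i) ^ 2)))) ≤
      ∫⁻ z', F (z, z') ∂π := by
    have hB0 : 0 ≤ B :=
      (abs_nonneg _).trans (hB z (Classical.choice (nonempty_of_isProbabilityMeasure ν)))
    have := ofReal_exp_mul_integral_le ν (n := n)
      (f := fun x => b / 2 * (g z x - b * g z x ^ 2)) (B := b / 2 * (B + b * B ^ 2))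
      (((hgz z).sub (((hgz z).pow_const 2).const_mul b)).const_mul _)
      (fun x => by
        have h1 := hB z x
        have h2 : g z x ^ 2 ≤ B ^ 2 := sq_le_sq' (by linarith [neg_abs_le (g z x)])
          ((le_abs_self _).trans h1)
        rw [abs_mul, abs_of_nonneg (by positivity : 0 ≤ b / 2)]
        refine mul_le_mul_of_nonneg_left ?_ (by positivity)
        refine (abs_sub _ _).trans (add_le_add h1 ?_)
        rw [abs_of_nonneg (by positivity)]
        exact mul_le_mul_of_nonneg_left h2 hb)
      (-(b / 2) * ∑ i, (g z (z i) + b * g z (z i) ^ 2))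
    rw [integral_const_mul] at this
    refine (le_of_eq ?_).trans (this.trans (le_of_eq ?_))
    · congr 2; ring
    · refine lintegral_congr fun w => ?_
      simp only [hFdef]
      congr 2
      rw [← Finset.mul_sum, neg_mul, neg_add_eq_sub, ← mul_sub, ← Finset.sum_sub_distrib]
      congr 1
      refine Finset.sum_congr rfl fun i _ => ?_
      ring
  -- For a fixed double sample, an exchange flips the sign of the difference in a coordinate and
  -- leaves the symmetric offset unchanged. It also changes the first sample, hence the selected
  -- function, so the covers must serve every `g z` at once.
  have hswap : ∀ ω ω', (∃ t : Finset (Fin n → ℝ), (t.card : ℝ) ≤ N ∧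
      ∀ z, ∃ v ∈ t, ∑ i, (g z (Z ω i) - v i) ^ 2 ≤ n * ε ^ 2) →
      (∃ t : Finset (Fin n → ℝ), (t.card : ℝ) ≤ N ∧
      ∀ z, ∃ v ∈ t, ∑ i, (g z (Z ω' i) - v i) ^ 2 ≤ n * ε ^ 2) →
      (2 ^ n)⁻¹ * ∑ σ : Fin n → Bool, F (swapSample σ (Z ω, Z ω')) ≤
        ENNReal.ofReal (N * Real.exp (b * n * (ε + b * ε ^ 2))) := by
    rintro ω ω' ⟨t, ht, hu⟩ ⟨t', ht', hu'⟩
    have h := sum_exp_rademacher_pair_le hb hε t t' ht ht'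
      (fun σ i => g (swapSample σ (Z ω, Z ω')).1 (Z ω i))
      (fun σ i => g (swapSample σ (Z ω, Z ω')).1 (Z ω' i)) (fun σ => hu _) (fun σ => hu' _)
    have hFσ (σ : Fin n → Bool) : F (swapSample σ (Z ω, Z ω')) = ENNReal.ofReal (Real.exp (b / 2 *
        ∑ i, (rademacher (σ i) * (g (swapSample σ (Z ω, Z ω')).1 (Z ω' i) -
          g (swapSample σ (Z ω, Z ω')).1 (Z ω i)) -
          b * (g (swapSample σ (Z ω, Z ω')).1 (Z ω i) ^ 2 +
            g (swapSample σ (Z ω, Z ω')).1 (Z ω' i) ^ 2)))) := by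
      simp only [hFdef]
      congr 3
      refine Finset.sum_congr rfl fun i _ => ?_
      generalize g (swapSample σ (Z ω, Z ω')).1 = f
      by_cases hi : σ i <;> simp only [swapSample, rademacher, hi, if_true, Bool.false_eq_true,
        if_false] <;> ring
    simp_rw [hFσ]
    rw [← ENNReal.ofReal_sum_of_nonneg fun σ _ => (Real.exp_pos _).le]
    refine (mul_le_mul_right (ENNReal.ofReal_le_ofReal h) _).trans_eq ?_
    rw [ENNReal.ofReal_mul (by positivity), ENNReal.ofReal_pow (by norm_num), ← mul_assoc,
      ENNReal.ofReal_ofNat, ENNReal.inv_mul_cancel (by positivity) (by finiteness), one_mul]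
  have hGm : Measurable fun w => (2 ^ n)⁻¹ * ∑ σ : Fin n → Bool, F (swapSample σ w) :=
    (Finset.measurable_sum _ fun σ _ =>
      hF.comp (measurePreserving_swapSample ν σ).measurable).const_mul _
  calc _ ≤ ∫⁻ ω, ∫⁻ z', F (Z ω, z') ∂π ∂P := lintegral_mono fun ω => hjensen (Z ω)
    _ = ∫⁻ z, ∫⁻ z', F (z, z') ∂π ∂π := by
      rw [← hlaw, lintegral_map hF.lintegral_prod_right' hZ]
    _ = ∫⁻ w, F w ∂(π.prod π) := (lintegral_prod _ hF.aemeasurable).symm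
    _ = ∫⁻ w, (2 ^ n)⁻¹ * ∑ σ : Fin n → Bool, F (swapSample σ w) ∂(π.prod π) :=
      lintegral_eq_lintegral_sum_swapSample ν hF
    _ = ∫⁻ z, ∫⁻ z', (2 ^ n)⁻¹ * ∑ σ : Fin n → Bool, F (swapSample σ (z, z')) ∂π ∂π :=
      lintegral_prod _ hGm.aemeasurable
    -- The covering hypothesis holds almost surely on `Ω`, and the event is not assumed measurable
    -- in the sample; hence the return from the product law to two copies of `P`.
    _ = ∫⁻ ω, ∫⁻ ω', (2 ^ n)⁻¹ * ∑ σ : Fin n → Bool, F (swapSample σ (Z ω, Z ω')) ∂P ∂P := by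
      rw [← hlaw, lintegral_map hGm.lintegral_prod_right' hZ]
      exact lintegral_congr fun ω => lintegral_map (hGm.comp measurable_prodMk_left) hZ
    _ ≤ ∫⁻ _, ∫⁻ _, ENNReal.ofReal (N * Real.exp (b * n * (ε + b * ε ^ 2))) ∂P ∂P := by
      refine lintegral_mono_ae ?_
      filter_upwards [hcov] with ω hω
      refine lintegral_mono_ae ?_
      filter_upwards [hcov] with ω' hω'
      exact hswap ω ω' hω hω'
    _ = _ := by simp

/-- Chernoff's bound: Markov's inequality for `exp X` at level `K exp s`. -/
theorem measure_log_add_le_le_exp_neg {Ω : Type*} [MeasurableSpace Ω] (P : Measure Ω) {X : Ω → ℝ}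
    (hX : Measurable X) {K : ℝ} (hK : 0 < K)
    (h : ∫⁻ ω, ENNReal.ofReal (Real.exp (X ω)) ∂P ≤ ENNReal.ofReal K) (s : ℝ) :
    P {ω | Real.log K + s ≤ X ω} ≤ ENNReal.ofReal (Real.exp (-s)) := by
  have hpos : 0 < K * Real.exp s := by positivity
  have hset : {ω | Real.log K + s ≤ X ω} =
      {ω | ENNReal.ofReal (K * Real.exp s) ≤ ENNReal.ofReal (Real.exp (X ω))} := by
    ext ω
    rw [Set.mem_ofPred_eq, Set.mem_ofPred_eq, ENNReal.ofReal_le_ofReal_iff (Real.exp_pos _).le,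
      ← Real.exp_le_exp, Real.exp_add, Real.exp_log hK]
  rw [hset]
  refine (meas_ge_le_lintegral_div (Real.measurable_exp.comp hX).ennreal_ofReal.aemeasurable
    (ENNReal.ofReal_pos.2 hpos).ne' ENNReal.ofReal_ne_top).trans ?_
  refine (ENNReal.div_le_div_right h _).trans_eq ?_
  rw [← ENNReal.ofReal_div_of_pos hpos, Real.exp_neg]
  congr 1
  field_simp

/-! ### The loss at a point and on the sample -/

section Pointwise

variable {Λ E F : Type*} {ψ : Λ → F → ℝ} {z : E × F} {S S' : Λ → E → ℝ} {C : ℝ}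

theorem summable_sq_add_abs
    (h : ∑' l, ENNReal.ofReal (S l z.1 ^ 2 + |ψ l z.2 * S l z.1|) ≤ ENNReal.ofReal C) :
    Summable fun l => S l z.1 ^ 2 + |ψ l z.2 * S l z.1| := by
  have h1 : ∑' l, ENNReal.ofReal (S l z.1 ^ 2 + |ψ l z.2 * S l z.1|) ≠ ∞ :=
    (h.trans_lt ENNReal.ofReal_lt_top).ne
  refine (ENNReal.summable_toReal h1).congr fun l => ?_
  rw [ENNReal.toReal_ofReal (by positivity)]

theorem tsum_sq_add_abs_le (hC : 0 ≤ C)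
    (h : ∑' l, ENNReal.ofReal (S l z.1 ^ 2 + |ψ l z.2 * S l z.1|) ≤ ENNReal.ofReal C) :
    ∑' l, (S l z.1 ^ 2 + |ψ l z.2 * S l z.1|) ≤ C := by
  rwa [← ENNReal.ofReal_tsum_of_nonneg (fun l => by positivity) (summable_sq_add_abs h),
    ENNReal.ofReal_le_ofReal_iff hC] at h

theorem abs_loss_term_le (l : Λ) : |S l z.1 ^ 2 - 2 * ψ l z.2 * S l z.1| ≤
    2 * (S l z.1 ^ 2 + |ψ l z.2 * S l z.1|) := by
  have := abs_le.1 (le_refl |ψ l z.2 * S l z.1|)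
  rw [abs_le]
  constructor <;> nlinarith [sq_nonneg (S l z.1)]

theorem summable_loss
    (h : ∑' l, ENNReal.ofReal (S l z.1 ^ 2 + |ψ l z.2 * S l z.1|) ≤ ENNReal.ofReal C) :
    Summable fun l => S l z.1 ^ 2 - 2 * ψ l z.2 * S l z.1 :=
  Summable.of_norm_bounded ((summable_sq_add_abs h).mul_left 2) abs_loss_term_le

theorem abs_loss_le (hC : 0 ≤ C)
    (h : ∑' l, ENNReal.ofReal (S l z.1 ^ 2 + |ψ l z.2 * S l z.1|) ≤ ENNReal.ofReal C) :
    |loss ψ z S| ≤ 2 * C := by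
  have h1 := tsum_of_norm_bounded (f := fun l => S l z.1 ^ 2 - 2 * ψ l z.2 * S l z.1)
    ((summable_sq_add_abs h).mul_left 2).hasSum abs_loss_term_le
  rw [tsum_mul_left] at h1
  exact h1.trans (mul_le_mul_of_nonneg_left (tsum_sq_add_abs_le hC h) zero_le_two)

/-- The least squares criterion and the loss differ by `∑ ψ_λ²`, which is finite and does not
involve `S`; a minimiser of one therefore minimises the other. -/
theorem tsum_ofReal_sub_sq_eq
    (h : ∑' l, ENNReal.ofReal (S l z.1 ^ 2 + |ψ l z.2 * S l z.1|) ≤ ENNReal.ofReal C)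
    (hψ : Summable fun l => ψ l z.2 ^ 2) :
    ∑' l, ENNReal.ofReal ((S l z.1 - ψ l z.2) ^ 2) =
      ENNReal.ofReal (loss ψ z S + ∑' l, ψ l z.2 ^ 2) ∧
    0 ≤ loss ψ z S + ∑' l, ψ l z.2 ^ 2 := by
  have e (l : Λ) : (S l z.1 - ψ l z.2) ^ 2 =
      (S l z.1 ^ 2 - 2 * ψ l z.2 * S l z.1) + ψ l z.2 ^ 2 := by ring
  have hs := (summable_loss h).add hψ
  rw [loss, ← (summable_loss h).tsum_add hψ]
  refine ⟨?_, tsum_nonneg fun l => (e l) ▸ sq_nonneg _⟩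
  rw [ENNReal.ofReal_tsum_of_nonneg (fun l => (e l) ▸ sq_nonneg _) hs]
  simp_rw [e]

theorem sum_loss_le_of_empRisk_le {n : ℕ} (hn : n ≠ 0) {z : Fin n → E × F}
    (hS : ∀ i, ∑' l, ENNReal.ofReal (S l (z i).1 ^ 2 + |ψ l (z i).2 * S l (z i).1|)
      ≤ ENNReal.ofReal C)
    (hS' : ∀ i, ∑' l, ENNReal.ofReal (S' l (z i).1 ^ 2 + |ψ l (z i).2 * S' l (z i).1|)
      ≤ ENNReal.ofReal C)
    (hψ : ∀ i, Summable fun l => ψ l (z i).2 ^ 2) (h : empRisk ψ z S ≤ empRisk ψ z S') :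
    ∑ i, loss ψ (z i) S ≤ ∑ i, loss ψ (z i) S' := by
  have a (i) := tsum_ofReal_sub_sq_eq (hS i) (hψ i)
  have a' (i) := tsum_ofReal_sub_sq_eq (hS' i) (hψ i)
  rw [empRisk, empRisk, ENNReal.mul_le_mul_iff_right (by simp) (by simpa using hn)] at h
  simp_rw [fun i => (a i).1, fun i => (a' i).1] at h
  rw [← ENNReal.ofReal_sum_of_nonneg fun i _ => (a i).2,
    ← ENNReal.ofReal_sum_of_nonneg fun i _ => (a' i).2,
    ENNReal.ofReal_le_ofReal_iff (Finset.sum_nonneg fun i _ => (a' i).2),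
    Finset.sum_add_distrib, Finset.sum_add_distrib] at h
  linarith

end Pointwise

/-! ### Population risk and distance to the regression function -/

section Risk

variable {Λ E F : Type*} [MeasurableSpace E] [MeasurableSpace F]

theorem measurable_loss [Countable Λ] {ψ : Λ → F → ℝ} (hψ : ∀ l, Measurable (ψ l)) {S : Λ → E → ℝ}
    (hS : ∀ l, Measurable (S l)) : Measurable fun z : E × F => loss ψ z S :=
  Measurable.tsum fun l => (((hS l).comp measurable_fst).pow_const 2).sub
    ((((hψ l).comp measurable_snd).const_mul 2).mul ((hS l).comp measurable_fst))

theorem sqDist_comm (μ : Measure E) (S S' : Λ → E → ℝ) : sqDist μ S S' = sqDist μ S' S := by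
  simp only [sqDist, ← sub_sq_comm]

theorem sqDist_le_two_mul_add [Countable Λ] (μ : Measure E) {S S' S'' : Λ → E → ℝ}
    (hS : ∀ l, Measurable (S l))
    (hS' : ∀ l, Measurable (S' l)) :
    sqDist μ S S'' ≤ 2 * sqDist μ S S' + 2 * sqDist μ S' S'' := by
  have hm : Measurable fun x => ∑' l, ENNReal.ofReal ((S l x - S' l x) ^ 2) :=
    Measurable.tsum fun l => (((hS l).sub (hS' l)).pow_const 2).ennreal_ofReal
  rw [sqDist, sqDist, sqDist, ← mul_add, ← lintegral_add_left hm,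
    ← lintegral_const_mul' _ _ (by simp)]
  refine lintegral_mono fun x => ?_
  rw [← ENNReal.tsum_add, ← ENNReal.tsum_mul_left]
  refine ENNReal.tsum_le_tsum fun l => ?_
  rw [← ENNReal.ofReal_add (sq_nonneg _) (sq_nonneg _),
    show (2 : ℝ≥0∞) = ENNReal.ofReal 2 by simp, ← ENNReal.ofReal_mul zero_le_two]
  refine ENNReal.ofReal_le_ofReal ?_
  nlinarith [sq_nonneg ((S l x - S' l x) - (S' l x - S'' l x))]

theorem sqDist_zero_le [Countable Λ] (μ : Measure E) [IsProbabilityMeasure μ]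
    {κ : Kernel E F} [IsMarkovKernel κ] {ψ : Λ → F → ℝ} {S : Λ → E → ℝ} (hS : ∀ l, Measurable (S l)) {C : ℝ}
    (h : ∀ᵐ z ∂(μ.compProd κ),
      ∑' l, ENNReal.ofReal (S l z.1 ^ 2 + |ψ l z.2 * S l z.1|) ≤ ENNReal.ofReal C) :
    sqDist μ S 0 ≤ ENNReal.ofReal C := by
  have hm : Measurable fun x => ∑' l, ENNReal.ofReal ((S l x - (0 : Λ → E → ℝ) l x) ^ 2) :=
    Measurable.tsum fun l => (((hS l).sub measurable_const).pow_const 2).ennreal_ofReal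
  rw [sqDist, ← Measure.fst_compProd μ κ, Measure.fst, lintegral_map hm measurable_fst]
  calc _ ≤ ∫⁻ _, ENNReal.ofReal C ∂(μ.compProd κ) := by
        refine lintegral_mono_ae ?_
        filter_upwards [h] with z hz
        refine le_trans (ENNReal.tsum_le_tsum fun l => ENNReal.ofReal_le_ofReal ?_) hz
        simp only [Pi.zero_apply, sub_zero, le_add_iff_nonneg_right, abs_nonneg]
    _ = _ := by simp

theorem integrable_sq_of_sqDist_zero [Countable Λ] {μ : Measure E} {f : Λ → E → ℝ}
    (hf : ∀ l, Measurable (f l))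
    (h : sqDist μ f 0 ≠ ∞) :
    (∀ l, Integrable (fun x => f l x ^ 2) μ) ∧
      HasSum (fun l => ∫ x, f l x ^ 2 ∂μ) (sqDist μ f 0).toReal := by
  have hm (l) : Measurable fun x => ENNReal.ofReal (f l x ^ 2) :=
    ((hf l).pow_const 2).ennreal_ofReal
  have e : sqDist μ f 0 = ∑' l, ∫⁻ x, ENNReal.ofReal (f l x ^ 2) ∂μ := by
    rw [← lintegral_tsum fun l => (hm l).aemeasurable]
    simp [sqDist]
  rw [e] at h ⊢
  have hl (l) := ENNReal.ne_top_of_tsum_ne_top h l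
  have e' (l) : ∫ x, f l x ^ 2 ∂μ = (∫⁻ x, ENNReal.ofReal (f l x ^ 2) ∂μ).toReal :=
    integral_eq_lintegral_of_nonneg_ae (ae_of_all _ fun x => sq_nonneg _)
      ((hf l).pow_const 2).aestronglyMeasurable
  refine ⟨fun l => ⟨((hf l).pow_const 2).aestronglyMeasurable, ?_⟩, ?_⟩
  · rw [hasFiniteIntegral_iff_ofReal (ae_of_all _ fun x => sq_nonneg _)]
    exact (hl l).lt_top
  · simp_rw [e']
    rw [ENNReal.tsum_toReal_eq hl]
    exact ENNReal.hasSum_toReal h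

theorem measurable_condMean {κ : Kernel E F} [IsMarkovKernel κ] {ψ : Λ → F → ℝ}
    (hψ : ∀ l, Measurable (ψ l)) (l : Λ) : Measurable (condMean κ ψ l) :=
  (StronglyMeasurable.integral_kernel (κ := κ) (hψ l).stronglyMeasurable).measurable

/-- The terms are dominated by `2 (S² + |ψ S|)`, whose sum is bounded almost everywhere by `2C`, so
sum and integral may be exchanged. Disintegration then replaces `ψ` by its conditional mean in the
cross term. -/
theorem hasSum_integral_loss [Countable Λ] {μ : Measure E} [IsProbabilityMeasure μ] {κ : Kernel E F}
    [IsMarkovKernel κ] {ψ : Λ → F → ℝ} (hψ : ∀ l, Measurable (ψ l)) {S : Λ → E → ℝ}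
    (hS : ∀ l, Measurable (S l)) {C : ℝ}
    (h : ∀ᵐ z ∂(μ.compProd κ),
      ∑' l, ENNReal.ofReal (S l z.1 ^ 2 + |ψ l z.2 * S l z.1|) ≤ ENNReal.ofReal C) :
    HasSum (fun l => ∫ x, S l x ^ 2 ∂μ - 2 * ∫ x, S l x * condMean κ ψ l x ∂μ)
      (∫ z, loss ψ z S ∂(μ.compProd κ)) := by
  set ν := μ.compProd κ with hν
  have hS1 (l) : Measurable fun z : E × F => S l z.1 := (hS l).comp measurable_fst
  have hψ2 (l) : Measurable fun z : E × F => ψ l z.2 := (hψ l).comp measurable_snd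
  have hq (l) : Measurable fun z : E × F => S l z.1 ^ 2 + |ψ l z.2 * S l z.1| :=
    ((hS1 l).pow_const 2).add (continuous_abs.measurable.comp ((hψ2 l).mul (hS1 l)))
  have htop : ∑' l, ∫⁻ z, ENNReal.ofReal (S l z.1 ^ 2 + |ψ l z.2 * S l z.1|) ∂ν ≠ ∞ := by
    rw [← lintegral_tsum fun l => (hq l).ennreal_ofReal.aemeasurable]
    refine ((lintegral_mono_ae h).trans_lt ?_).ne
    simp
  have hqi (l) : Integrable (fun z : E × F => S l z.1 ^ 2 + |ψ l z.2 * S l z.1|) ν := by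
    refine ⟨(hq l).aestronglyMeasurable, ?_⟩
    rw [hasFiniteIntegral_iff_ofReal (ae_of_all _ fun x => by positivity)]
    exact (ENNReal.ne_top_of_tsum_ne_top htop l).lt_top
  have hqs : Summable fun l => ∫ z, (S l z.1 ^ 2 + |ψ l z.2 * S l z.1|) ∂ν := by
    refine (ENNReal.summable_toReal htop).congr fun l => ?_
    rw [integral_eq_lintegral_of_nonneg_ae (ae_of_all _ fun x => by positivity)
      (hq l).aestronglyMeasurable]
  have hLi (l) : Integrable (fun z : E × F => S l z.1 ^ 2 - 2 * ψ l z.2 * S l z.1) ν :=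
    ((hqi l).const_mul 2).mono'
      (((hS1 l).pow_const 2).sub (((hψ2 l).const_mul 2).mul (hS1 l))).aestronglyMeasurable
      (ae_of_all _ fun z => abs_loss_term_le l)
  have hLs : Summable fun l => ∫ z, ‖S l z.1 ^ 2 - 2 * ψ l z.2 * S l z.1‖ ∂ν := by
    refine Summable.of_nonneg_of_le (fun l => integral_nonneg fun z => norm_nonneg _) (fun l => ?_)
      (hqs.mul_left 2)
    rw [← integral_const_mul]
    exact integral_mono (hLi l).norm ((hqi l).const_mul 2) fun z => abs_loss_term_le l
  have key := hasSum_integral_of_summable_integral_norm hLi hLs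
  have hSi (l) : Integrable (fun z : E × F => S l z.1 ^ 2) ν :=
    (hqi l).mono' ((hS1 l).pow_const 2).aestronglyMeasurable (ae_of_all _ fun z => by
      rw [Real.norm_of_nonneg (sq_nonneg _)]
      linarith [abs_nonneg (ψ l z.2 * S l z.1)])
  have hPi (l) : Integrable (fun z : E × F => S l z.1 * ψ l z.2) ν :=
    (hqi l).mono' ((hS1 l).mul (hψ2 l)).aestronglyMeasurable (ae_of_all _ fun z => by
      rw [Real.norm_eq_abs, mul_comm]
      linarith [sq_nonneg (S l z.1)])
  have e1 (l) : ∫ z, S l z.1 ^ 2 ∂ν = ∫ x, S l x ^ 2 ∂μ := by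
    conv_rhs => rw [← Measure.fst_compProd μ κ, Measure.fst]
    rw [integral_map measurable_fst.aemeasurable ((hS l).pow_const 2).aestronglyMeasurable]
  have e2 (l) : ∫ z, S l z.1 * ψ l z.2 ∂ν = ∫ x, S l x * condMean κ ψ l x ∂μ := by
    rw [hν, Measure.integral_compProd (hPi l)]
    simp_rw [integral_const_mul]
    rfl
  have e3 : (fun l => ∫ x, S l x ^ 2 ∂μ - 2 * ∫ x, S l x * condMean κ ψ l x ∂μ) =
      fun l => ∫ z, S l z.1 ^ 2 - 2 * ψ l z.2 * S l z.1 ∂ν := by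
    funext l
    rw [← e1, ← e2, ← integral_const_mul, ← integral_sub (hSi l) ((hPi l).const_mul 2)]
    refine integral_congr_ae (ae_of_all _ fun z => ?_)
    simp only
    ring
  rw [e3]
  exact key

/-- The excess risk identity: the risk and the squared distance to the regression function differ
by a constant. -/
theorem toReal_sqDist_condMean [Countable Λ] {μ : Measure E} [IsProbabilityMeasure μ] {κ : Kernel E F}
    [IsMarkovKernel κ] {ψ : Λ → F → ℝ} (hψ : ∀ l, Measurable (ψ l)) {S : Λ → E → ℝ}
    (hS : ∀ l, Measurable (S l)) {C : ℝ}
    (h : ∀ᵐ z ∂(μ.compProd κ),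
      ∑' l, ENNReal.ofReal (S l z.1 ^ 2 + |ψ l z.2 * S l z.1|) ≤ ENNReal.ofReal C)
    (hm : sqDist μ (condMean κ ψ) 0 ≠ ∞) :
    sqDist μ S (condMean κ ψ) ≠ ∞ ∧ (sqDist μ S (condMean κ ψ)).toReal =
      ∫ z, loss ψ z S ∂(μ.compProd κ) + (sqDist μ (condMean κ ψ) 0).toReal := by
  set m := condMean κ ψ with hmdef
  have mm (l) : Measurable (m l) := measurable_condMean hψ l
  have hS0 : sqDist μ S 0 ≠ ∞ := ((sqDist_zero_le μ hS h).trans_lt ENNReal.ofReal_lt_top).ne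
  have htop : sqDist μ S m ≠ ∞ := by
    refine ((sqDist_le_two_mul_add μ hS (S' := 0) fun l => measurable_const).trans_lt ?_).ne
    rw [sqDist_comm μ 0 m]
    finiteness
  refine ⟨htop, ?_⟩
  have e : sqDist μ S m = sqDist μ (fun l x => S l x - m l x) 0 := by simp [sqDist]
  rw [e] at htop ⊢
  obtain ⟨-, hD⟩ := integrable_sq_of_sqDist_zero (fun l => (hS l).sub (mm l)) htop
  obtain ⟨iS, -⟩ := integrable_sq_of_sqDist_zero hS hS0
  obtain ⟨im, hM⟩ := integrable_sq_of_sqDist_zero mm hm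
  refine hD.unique ?_
  -- The identity is checked for each `λ`, where it is the expansion of `(S - m)²`; uniqueness of
  -- sums does the rest.
  convert (hasSum_integral_loss hψ hS h).add hM using 2 with l
  have iSm : Integrable (fun x => S l x * m l x) μ :=
    ((memLp_two_iff_integrable_sq (hS l).aestronglyMeasurable).2 (iS l)).integrable_mul
      ((memLp_two_iff_integrable_sq (mm l).aestronglyMeasurable).2 (im l))
  have iSm2 : Integrable (fun x => S l x ^ 2 - 2 * (S l x * m l x)) μ :=
    (iS l).sub (iSm.const_mul 2)
  rw [← hmdef, ← integral_const_mul, ← integral_sub (iS l) (iSm.const_mul 2),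
    ← integral_add iSm2 (im l)]
  refine integral_congr_ae (ae_of_all _ fun x => ?_)
  simp only [Pi.sub_apply]
  ring

end Risk

/-! ### Truncated quadratic transform of the loss difference -/

/-- Truncation of a real number to the interval `[-B, B]`. -/
noncomputable def clip (B x : ℝ) : ℝ := max (min x B) (-B)

theorem abs_clip_le {B : ℝ} (hB : 0 ≤ B) (x : ℝ) : |clip B x| ≤ B :=
  abs_le.2 ⟨le_max_right _ _, max_le (min_le_right _ _) (by linarith)⟩

theorem abs_clip_sub_clip_le (B x y : ℝ) : |clip B x - clip B y| ≤ |x - y| :=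
  (abs_max_sub_max_le_abs _ _ _).trans
    ((abs_min_sub_min_le_max _ _ _ _).trans (by simp))

theorem clip_of_abs_le {B x : ℝ} (h : |x| ≤ B) : clip B x = x := by
  rw [clip, min_eq_left (abs_le.1 h).2, max_eq_left (abs_le.1 h).1]

theorem measurable_clip (B : ℝ) : Measurable (clip B) :=
  (measurable_id.min measurable_const).max measurable_const

/-- The transform `h ↦ h - h² / (16 C)` of a loss difference truncated to `[-4 C, 4 C]`. -/
noncomputable def offsetClip (C x : ℝ) : ℝ := clip (4 * C) x - clip (4 * C) x ^ 2 / (16 * C)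

theorem measurable_offsetClip (C : ℝ) : Measurable (offsetClip C) :=
  (measurable_clip _).sub (((measurable_clip _).pow_const 2).div_const _)

section offsetClip

variable {C : ℝ} (hC : 0 < C)
include hC

theorem exists_clip_eq_mul (x : ℝ) : ∃ s, |s| ≤ 1 ∧ clip (4 * C) x = 4 * C * s := by
  refine ⟨clip (4 * C) x / (4 * C), ?_, by field_simp⟩
  rw [abs_div, abs_of_pos (by positivity : 0 < 4 * C), div_le_one (by positivity)]
  exact abs_clip_le (by positivity) x

theorem offsetClip_of_clip_eq_mul {x s : ℝ} (hs : clip (4 * C) x = 4 * C * s) :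
    offsetClip C x = C * (4 * s - s ^ 2) := by
  rw [offsetClip, hs]
  field_simp
  ring

theorem abs_offsetClip_le (x : ℝ) : |offsetClip C x| ≤ 5 * C := by
  obtain ⟨s, hs, e⟩ := exists_clip_eq_mul hC x
  rw [offsetClip_of_clip_eq_mul hC e, abs_mul, abs_of_pos hC, mul_comm]
  refine mul_le_mul_of_nonneg_right ?_ hC.le
  rw [abs_le] at hs ⊢
  constructor <;> nlinarith

/-- The derivative of `h - h²/(16C)` on `[-4C, 4C]` is at most `1 + 1/2`, and truncation is a
contraction; so the transform is Lipschitz with constant `3/2`. -/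
theorem offsetClip_sub_sq_le (x y : ℝ) :
    (offsetClip C x - offsetClip C y) ^ 2 ≤ 9 / 4 * (x - y) ^ 2 := by
  obtain ⟨s, hs, e⟩ := exists_clip_eq_mul hC x
  obtain ⟨t, ht, e'⟩ := exists_clip_eq_mul hC y
  have h : (4 * C * (s - t)) ^ 2 ≤ (x - y) ^ 2 := by
    rw [mul_sub, ← e, ← e']
    exact sq_le_sq.2 (abs_clip_sub_clip_le _ _ _)
  have h2 : (4 - (s + t)) ^ 2 ≤ 36 := by
    rw [abs_le] at hs ht
    nlinarith
  rw [offsetClip_of_clip_eq_mul hC e, offsetClip_of_clip_eq_mul hC e']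
  calc _ = (C * (s - t)) ^ 2 * (4 - (s + t)) ^ 2 := by ring
    _ ≤ (C * (s - t)) ^ 2 * 36 := mul_le_mul_of_nonneg_left h2 (sq_nonneg _)
    _ ≤ _ := by nlinarith

/-- With `x = 4Cs` and `|s| ≤ 1`, the added square is `C s² (4 - s)²/32 ≤ C s²`, exactly what the
transform has subtracted. This serves the empirical side. -/
theorem offsetClip_add_le {x : ℝ} (hx : |x| ≤ 4 * C) :
    offsetClip C x + 1 / (32 * C) * offsetClip C x ^ 2 ≤ x := by
  obtain ⟨s, hs, e⟩ := exists_clip_eq_mul hC x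
  rw [offsetClip_of_clip_eq_mul hC e]
  rw [clip_of_abs_le hx] at e
  have : 1 / (32 * C) * (C * (4 * s - s ^ 2)) ^ 2 = C * (s ^ 2 * (4 - s) ^ 2 / 32) := by
    field_simp
  rw [this, e]
  have h2 : (4 - s) ^ 2 ≤ 32 := by
    rw [abs_le] at hs
    nlinarith
  nlinarith [mul_le_mul_of_nonneg_left h2 (mul_nonneg hC.le (sq_nonneg s))]

/-- The counterpart for the population side: both subtracted squares cost at most `C s²` each,
together `2C s² = x²/(8C)`. -/
theorem le_offsetClip_sub {x : ℝ} (hx : |x| ≤ 4 * C) :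
    x - 1 / (8 * C) * x ^ 2 ≤ offsetClip C x - 1 / (32 * C) * offsetClip C x ^ 2 := by
  obtain ⟨s, hs, e⟩ := exists_clip_eq_mul hC x
  rw [offsetClip_of_clip_eq_mul hC e]
  rw [clip_of_abs_le hx] at e
  have h1 : 1 / (32 * C) * (C * (4 * s - s ^ 2)) ^ 2 = C * (s ^ 2 * (4 - s) ^ 2 / 32) := by
    field_simp
  have h3 : 1 / (8 * C) * (4 * C * s) ^ 2 = C * (2 * s ^ 2) := by
    field_simp
    ring
  rw [h1, e, h3]
  have h2 : (4 - s) ^ 2 ≤ 32 := by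
    rw [abs_le] at hs
    nlinarith
  nlinarith [mul_le_mul_of_nonneg_left h2 (mul_nonneg hC.le (sq_nonneg s))]

end offsetClip

/-! ### Finite covers from the entropy assumption -/

section Cover

variable {Λ E F : Type*} {n : ℕ} {ψ : Λ → F → ℝ} {z : Fin n → E × F} {𝒮 : Set (Λ → E → ℝ)}

theorem exists_finset_cover {S₀ : Λ → E → ℝ} (hS₀ : S₀ ∈ 𝒮) {W T : ℝ} (hW : 0 ≤ W)
    {ε : ℝ≥0} (hT : (ε : ℝ) ≤ T) (hε : 0 < ε)
    (h : (ε : ℝ≥0∞) ≤ (⨆ S ∈ 𝒮, ⨆ S' ∈ 𝒮, ENNReal.ofReal (empDist ψ z S S')) →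
      (empCoveringNumber ψ z 𝒮 ε : ℝ≥0∞) ≤ ENNReal.ofReal ((T / (ε : ℝ)) ^ W)) :
    ∃ D : Finset (Λ → E → ℝ), (D.card : ℝ) ≤ (T / ε) ^ W ∧
      ∀ S ∈ 𝒮, ∃ S' ∈ D, empDist ψ z S S' ≤ ε := by
  have hε' : (0 : ℝ) < ε := hε
  by_cases hd : (ε : ℝ≥0∞) ≤ ⨆ S ∈ 𝒮, ⨆ S' ∈ 𝒮, ENNReal.ofReal (empDist ψ z S S')
  · have hN := h hd
    let _ := empPseudoMetric ψ z
    have hfin : Metric.coveringNumber ε 𝒮 ≠ ⊤ := by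
      intro ht
      rw [empCoveringNumber, ht] at hN
      simp at hN
    obtain ⟨D, -, hDf, hDc, hDe⟩ := Metric.exists_set_encard_eq_coveringNumber hfin
    refine ⟨hDf.toFinset, ?_, fun S hS => ?_⟩
    · have hcard : (Metric.coveringNumber ε 𝒮) = (hDf.toFinset.card : ℕ∞) := by
        rw [← hDe, hDf.encard_eq_coe_toFinset_card]
      rw [empCoveringNumber, hcard, ENat.toENNReal_coe, ← ENNReal.ofReal_natCast,
        ENNReal.ofReal_le_ofReal_iff
          (Real.rpow_nonneg (div_nonneg (hε'.le.trans hT) hε'.le) _)] at hN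
      exact hN
    · obtain ⟨S', hS', hd'⟩ := hDc hS
      refine ⟨S', hDf.mem_toFinset.2 hS', ?_⟩
      have : edist S S' ≤ ε := hd'
      rw [edist_dist, ENNReal.ofReal_le_iff_le_toReal ENNReal.coe_ne_top] at this
      exact this
  -- The entropy assumption says nothing at scales above the diameter, but there a single ball
  -- around `S₀` suffices, and `1 ≤ (T/ε)^W` because `ε ≤ T`.
  · refine ⟨{S₀}, ?_, fun S hS => ⟨S₀, Finset.mem_singleton_self _, ?_⟩⟩
    · simpa using Real.one_le_rpow ((one_le_div hε').2 hT) hW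
    · have h1 : ENNReal.ofReal (empDist ψ z S S₀) ≤ ε :=
        le_trans (le_iSup₂_of_le S hS 
          (le_iSup₂ (f := fun S' (_ : S' ∈ 𝒮) => ENNReal.ofReal (empDist ψ z S S')) S₀ hS₀))
        (not_le.1 hd).le
      rwa [ENNReal.ofReal_le_iff_le_toReal ENNReal.coe_ne_top] at h1

theorem sum_loss_sub_sq_le (hn : n ≠ 0) {S S' : Λ → E → ℝ} {ε : ℝ} (hε : 0 ≤ ε)
    (h : empDist ψ z S S' ≤ ε) : ∑ i, (loss ψ (z i) S - loss ψ (z i) S') ^ 2 ≤ n * ε ^ 2 := by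
  rw [empDist, Real.sqrt_le_left hε, one_div, inv_mul_le_iff₀ (by positivity)] at h
  exact h

end Cover

/-! ### Tail bound for the estimator -/

theorem measurable_deviation {G Ω : Type*} [MeasurableSpace G] [MeasurableSpace Ω]
    (ν : Measure G) [SFinite ν] {n : ℕ} {Z : Ω → Fin n → G} (hZ : Measurable Z)
    {g : (Fin n → G) → G → ℝ} (hg : Measurable fun p : (Fin n → G) × G => g p.1 p.2) (b : ℝ) :
    Measurable fun ω => b / 2 * (n * ∫ x, (g (Z ω) x - b * g (Z ω) x ^ 2) ∂ν
      - ∑ i, (g (Z ω) (Z ω i) + b * g (Z ω) (Z ω i) ^ 2)) := by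
  have h1 : StronglyMeasurable fun p : (Fin n → G) × G =>
      g p.1 p.2 - b * g p.1 p.2 ^ 2 := (hg.sub ((hg.pow_const 2).const_mul b)).stronglyMeasurable
  have h2 : Measurable fun z => ∫ x, (g z x - b * g z x ^ 2) ∂ν :=
    (h1.integral_prod_right (ν := ν)).measurable
  have h3 (i : Fin n) : Measurable fun ω => g (Z ω) (Z ω i) :=
    hg.comp (hZ.prodMk ((measurable_pi_apply i).comp hZ))
  have h4 : Measurable fun ω => ∑ i, (g (Z ω) (Z ω i) + b * g (Z ω) (Z ω i) ^ 2) :=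
    Finset.measurable_sum _ fun i _ => (h3 i).add (((h3 i).pow_const 2).const_mul b)
  have h5 : Measurable fun ω => ∫ x, (g (Z ω) x - b * g (Z ω) x ^ 2) ∂ν := h2.comp hZ
  exact ((h5.const_mul _).sub h4).const_mul _

theorem measure_offsetClip_deviation_le {Λ E F Ω : Type*} [Countable Λ] [MeasurableSpace E]
    [MeasurableSpace F] [MeasurableSpace Ω] {C : ℝ} (hC : 0 < C) {n : ℕ} (hn : n ≠ 0)
    (ν : Measure (E × F)) [IsProbabilityMeasure ν] (P : Measure Ω) [IsProbabilityMeasure P]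
    {Z : Ω → Fin n → E × F} (hZ : Measurable Z) (hlaw : P.map Z = Measure.pi fun _ => ν)
    {ψ : Λ → F → ℝ} (hψ : ∀ l, Measurable (ψ l)) {𝒮 : Set (Λ → E → ℝ)}
    {S₀ : Λ → E → ℝ} (hS₀ : S₀ ∈ 𝒮) (hS₀m : ∀ l, Measurable (S₀ l))
    {W T : ℝ} (hW : 0 ≤ W) (hT : 1 ≤ T)
    (hcov : ∀ᵐ ω ∂P, ∀ ε : ℝ≥0, 0 < ε →
      (ε : ℝ≥0∞) ≤ (⨆ S ∈ 𝒮, ⨆ S' ∈ 𝒮, ENNReal.ofReal (empDist ψ (Z ω) S S')) →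
      (empCoveringNumber ψ (Z ω) 𝒮 ε : ℝ≥0∞) ≤ ENNReal.ofReal ((T / (ε : ℝ)) ^ W))
    {Shat : (Fin n → E × F) → Λ → E → ℝ}
    (hShatm : ∀ l, Measurable fun p : (Fin n → E × F) × E => Shat p.1 l p.2)
    (hShat : ∀ z, Shat z ∈ 𝒮) (s : ℝ) :
    P {ω | W * (Real.log n + Real.log T) + (3 / (64 * C) + 9 / (4 * (32 * C) ^ 2)) + s ≤
      1 / (64 * C) * (n * ∫ x, (offsetClip C (loss ψ x (Shat (Z ω)) - loss ψ x S₀) -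
            1 / (32 * C) * offsetClip C (loss ψ x (Shat (Z ω)) - loss ψ x S₀) ^ 2) ∂ν -
          ∑ i, (offsetClip C (loss ψ (Z ω i) (Shat (Z ω)) - loss ψ (Z ω i) S₀) +
            1 / (32 * C) * offsetClip C (loss ψ (Z ω i) (Shat (Z ω)) - loss ψ (Z ω i) S₀) ^ 2))} ≤
      ENNReal.ofReal (Real.exp (-s)) := by
  have hn1 : (1 : ℝ) ≤ n := by exact_mod_cast Nat.one_le_iff_ne_zero.2 hn
  have hn0 : (0 : ℝ) < n := by linarith
  set b : ℝ := 1 / (32 * C) with hb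
  have hb0 : 0 < b := by positivity
  set g : (Fin n → E × F) → E × F → ℝ :=
    fun z x => offsetClip C (loss ψ x (Shat z) - loss ψ x S₀) with hgdef
  have hg : Measurable fun p : (Fin n → E × F) × (E × F) => g p.1 p.2 := by
    have h1 : Measurable fun p : (Fin n → E × F) × (E × F) => loss ψ p.2 (Shat p.1) := by
      refine Measurable.tsum fun l => ?_
      have h2 : Measurable fun p : (Fin n → E × F) × (E × F) => Shat p.1 l p.2.1 :=
        (hShatm l).comp (measurable_fst.prodMk (measurable_fst.comp measurable_snd))
      have h3 : Measurable fun p : (Fin n → E × F) × (E × F) => ψ l p.2.2 :=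
        (hψ l).comp (measurable_snd.comp measurable_snd)
      exact (h2.pow_const 2).sub ((h3.const_mul 2).mul h2)
    exact (measurable_offsetClip C).comp (h1.sub ((measurable_loss hψ hS₀m).comp measurable_snd))
  -- The class is covered at scale `1/n`; the Lipschitz constant `3/2` turns this into `3/(2n)`. The
  -- cover then has at most `(T n)^W` points.
  set ε : ℝ := 3 / (2 * n) with hεdef
  have hε : 0 ≤ ε := by positivity
  set N : ℝ := (T * n) ^ W with hN
  have hN0 : 0 < N := by positivity
  have hcover : ∀ᵐ ω ∂P, ∃ t : Finset (Fin n → ℝ), (t.card : ℝ) ≤ N ∧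
      ∀ z, ∃ v ∈ t, ∑ i, (g z (Z ω i) - v i) ^ 2 ≤ n * ε ^ 2 := by
    classical
    filter_upwards [hcov] with ω hω
    have hδ : (((n : ℝ≥0)⁻¹ : ℝ≥0) : ℝ) = (n : ℝ)⁻¹ := by simp
    have hδT : (((n : ℝ≥0)⁻¹ : ℝ≥0) : ℝ) ≤ T := by
      rw [hδ]
      exact (inv_le_one_of_one_le₀ hn1).trans hT
    have hδ0 : 0 < (n : ℝ≥0)⁻¹ := by positivity
    obtain ⟨D, hD, hDc⟩ := exists_finset_cover hS₀ hW hδT hδ0 (hω _ hδ0)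
    refine ⟨D.image fun S i => offsetClip C (loss ψ (Z ω i) S - loss ψ (Z ω i) S₀), ?_,
      fun z => ?_⟩
    · refine (Nat.cast_le.2 Finset.card_image_le).trans ?_
      rwa [hδ, div_inv_eq_mul] at hD
    · obtain ⟨S, hS, hd⟩ := hDc _ (hShat z)
      refine ⟨_, Finset.mem_image_of_mem _ hS, ?_⟩
      have h1 := sum_loss_sub_sq_le hn (by positivity) hd
      calc _ ≤ ∑ i, 9 / 4 * (loss ψ (Z ω i) (Shat z) - loss ψ (Z ω i) S) ^ 2 := by
            refine Finset.sum_le_sum fun i _ => ?_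
            refine (offsetClip_sub_sq_le hC _ _).trans_eq ?_
            ring
        _ ≤ 9 / 4 * (n * ((n : ℝ)⁻¹) ^ 2) := by
            rw [← Finset.mul_sum, ← hδ]
            exact mul_le_mul_of_nonneg_left h1 (by norm_num)
        _ = n * ε ^ 2 := by
            rw [hεdef]
            field_simp
            norm_num
  have hdev := lintegral_exp_deviation_le ν P hZ hlaw hg (fun z x => abs_offsetClip_le hC _)
    hb0.le hε hcover
  have hX : Measurable fun ω => b / 2 * (n * ∫ x, (g (Z ω) x - b * g (Z ω) x ^ 2) ∂ν
          - ∑ i, (g (Z ω) (Z ω i) + b * g (Z ω) (Z ω i) ^ 2)) := 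
    measurable_deviation ν hZ hg b
  refine (measure_mono fun ω hω => ?_).trans
    (measure_log_add_le_le_exp_neg P hX (by positivity) hdev s)
  -- At this scale `b n ε = 3/(64C)` and `b² n ε² = 9/(4 (32C)² n)`, so the discretisation costs
  -- only a constant.
  have hlog : Real.log (N * Real.exp (b * n * (ε + b * ε ^ 2))) ≤
      W * (Real.log n + Real.log T) + (3 / (64 * C) + 9 / (4 * (32 * C) ^ 2)) := by
    rw [Real.log_mul hN0.ne' (Real.exp_pos _).ne', Real.log_exp, hN, Real.log_rpow (by positivity),
      Real.log_mul (by positivity) hn0.ne', add_comm (Real.log T)]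
    refine add_le_add le_rfl ?_
    have h1 : b * n * (ε + b * ε ^ 2) = 3 / (64 * C) + 9 / (4 * (32 * C) ^ 2) * (n : ℝ)⁻¹ := by
      rw [hεdef, hb]
      field_simp
      ring
    rw [h1]
    refine add_le_add le_rfl (mul_le_of_le_one_right (by positivity) (inv_le_one_of_one_le₀ hn1))
  have hω' : W * (Real.log n + Real.log T) + (3 / (64 * C) + 9 / (4 * (32 * C) ^ 2)) + s ≤
      1 / (64 * C) * (n * ∫ x, (g (Z ω) x - b * g (Z ω) x ^ 2) ∂ν
          - ∑ i, (g (Z ω) (Z ω i) + b * g (Z ω) (Z ω i) ^ 2)) := hω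
  have hb2 : 1 / (64 * C) = b / 2 := by
    rw [hb]
    field_simp
    norm_num
  rw [hb2] at hω'
  exact (add_le_add hlog le_rfl).trans hω'

/-! ### From the deviation bound to the oracle inequality -/

/-- From the deviation bound on one sample to the bound on the squared distance. -/
theorem toReal_sqDist_le_of_deviation_le {Λ E F : Type*} [Countable Λ] [MeasurableSpace E]
    [MeasurableSpace F] {C : ℝ} (hC : 0 < C) {n : ℕ} (hn : n ≠ 0) {μ : Measure E}
    [IsProbabilityMeasure μ] {κ : Kernel E F} [IsMarkovKernel κ]
    {ψ : Λ → F → ℝ} (hψ : ∀ l, Measurable (ψ l)) {S S₀ : Λ → E → ℝ}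
    (hS : ∀ l, Measurable (S l)) (hS₀ : ∀ l, Measurable (S₀ l))
    (hbS : ∀ᵐ z ∂(μ.compProd κ),
      ∑' l, ENNReal.ofReal (S l z.1 ^ 2 + |ψ l z.2 * S l z.1|) ≤ ENNReal.ofReal C)
    (hbS₀ : ∀ᵐ z ∂(μ.compProd κ),
      ∑' l, ENNReal.ofReal (S₀ l z.1 ^ 2 + |ψ l z.2 * S₀ l z.1|) ≤ ENNReal.ofReal C)
    (hvar : ∫⁻ z, ENNReal.ofReal ((loss ψ z S - loss ψ z S₀) ^ 2) ∂(μ.compProd κ) ≤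
      ENNReal.ofReal C * sqDist μ S S₀)
    (hm : sqDist μ (condMean κ ψ) 0 ≠ ∞) {z : Fin n → E × F}
    (hz : ∀ i, ∑' l, ENNReal.ofReal (S l (z i).1 ^ 2 + |ψ l (z i).2 * S l (z i).1|)
      ≤ ENNReal.ofReal C)
    (hz₀ : ∀ i, ∑' l, ENNReal.ofReal (S₀ l (z i).1 ^ 2 + |ψ l (z i).2 * S₀ l (z i).1|)
      ≤ ENNReal.ofReal C)
    (hmin : ∑ i, loss ψ (z i) S ≤ ∑ i, loss ψ (z i) S₀) {R : ℝ}
    (hdev : 1 / (64 * C) * (n * ∫ x, (offsetClip C (loss ψ x S - loss ψ x S₀) -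
            1 / (32 * C) * offsetClip C (loss ψ x S - loss ψ x S₀) ^ 2) ∂(μ.compProd κ) -
          ∑ i, (offsetClip C (loss ψ (z i) S - loss ψ (z i) S₀) +
            1 / (32 * C) * offsetClip C (loss ψ (z i) S - loss ψ (z i) S₀) ^ 2)) ≤ R) :
    (sqDist μ S (condMean κ ψ)).toReal ≤
      5 / 3 * (sqDist μ S₀ (condMean κ ψ)).toReal + 256 / 3 * C * R / n := by
  set ν := μ.compProd κ with hν
  have hn0 : (0 : ℝ) < n := by positivity
  have bound {x : E × F}
      (h : ∑' l, ENNReal.ofReal (S l x.1 ^ 2 + |ψ l x.2 * S l x.1|) ≤ ENNReal.ofReal C)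
      (h₀ : ∑' l, ENNReal.ofReal (S₀ l x.1 ^ 2 + |ψ l x.2 * S₀ l x.1|) ≤ ENNReal.ofReal C) :
      |loss ψ x S - loss ψ x S₀| ≤ 4 * C := by
    have h1 := abs_loss_le hC.le h
    have h2 := abs_loss_le hC.le h₀
    have h3 := abs_sub (loss ψ x S) (loss ψ x S₀)
    linarith
  have mS := measurable_loss hψ hS
  have mS₀ := measurable_loss hψ hS₀
  have mh : Measurable fun x => loss ψ x S - loss ψ x S₀ := mS.sub mS₀
  have iS : Integrable (fun x => loss ψ x S) ν := Integrable.of_bound mS.aestronglyMeasurable (2 * C)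
    (by filter_upwards [hbS] with x hx using abs_loss_le hC.le hx)
  have iS₀ : Integrable (fun x => loss ψ x S₀) ν :=
    Integrable.of_bound mS₀.aestronglyMeasurable (2 * C)
      (by filter_upwards [hbS₀] with x hx using abs_loss_le hC.le hx)
  have ih : Integrable (fun x => loss ψ x S - loss ψ x S₀) ν := iS.sub iS₀
  have ih2 : Integrable (fun x => (loss ψ x S - loss ψ x S₀) ^ 2) ν :=
    Integrable.of_bound (mh.pow_const 2).aestronglyMeasurable ((4 * C) ^ 2) (by
      filter_upwards [hbS, hbS₀] with x hx hx₀
      rw [Real.norm_of_nonneg (sq_nonneg _)]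
      exact sq_le_sq' (by linarith [abs_le.1 (bound hx hx₀)]) (abs_le.1 (bound hx hx₀)).2)
  have mo : Measurable fun x => offsetClip C (loss ψ x S - loss ψ x S₀) :=
    (measurable_offsetClip C).comp mh
  have io : Integrable (fun x => offsetClip C (loss ψ x S - loss ψ x S₀)) ν :=
    integrable_of_measurable_of_abs_le mo fun x => abs_offsetClip_le hC _
  have io2 : Integrable (fun x => offsetClip C (loss ψ x S - loss ψ x S₀) ^ 2) ν :=
    integrable_of_measurable_of_abs_le (mo.pow_const 2) (B := (5 * C) ^ 2) fun x => by
      have := abs_offsetClip_le hC (loss ψ x S - loss ψ x S₀)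
      rw [abs_of_nonneg (sq_nonneg _), ← sq_abs]
      gcongr
  obtain ⟨tS, eS⟩ := toReal_sqDist_condMean hψ hS hbS hm
  obtain ⟨tS₀, eS₀⟩ := toReal_sqDist_condMean hψ hS₀ hbS₀ hm
  have hpop : ∫ x, (loss ψ x S - loss ψ x S₀) ∂ν -
      1 / (8 * C) * ∫ x, (loss ψ x S - loss ψ x S₀) ^ 2 ∂ν ≤
      ∫ x, (offsetClip C (loss ψ x S - loss ψ x S₀) -
            1 / (32 * C) * offsetClip C (loss ψ x S - loss ψ x S₀) ^ 2) ∂ν := by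
    rw [← integral_const_mul, ← integral_sub ih (ih2.const_mul _)]
    refine integral_mono_ae (ih.sub (ih2.const_mul _)) (io.sub (io2.const_mul _)) ?_
    filter_upwards [hbS, hbS₀] with x hx hx₀ using le_offsetClip_sub hC (bound hx hx₀)
  have hemp : ∑ i, (offsetClip C (loss ψ (z i) S - loss ψ (z i) S₀) +
      1 / (32 * C) * offsetClip C (loss ψ (z i) S - loss ψ (z i) S₀) ^ 2) ≤ 0 := by
    refine (Finset.sum_le_sum fun i _ => offsetClip_add_le hC (bound (hz i) (hz₀ i))).trans ?_
    rw [Finset.sum_sub_distrib]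
    linarith
  set D := (sqDist μ S (condMean κ ψ)).toReal with hD
  set D₀ := (sqDist μ S₀ (condMean κ ψ)).toReal with hD₀
  have hmean : ∫ x, (loss ψ x S - loss ψ x S₀) ∂ν = D - D₀ := by
    rw [integral_sub iS iS₀, eS, eS₀]
    ring
  -- Assumption (2), followed by `‖S - S₀‖² ≤ 2 ‖S - m‖² + 2 ‖S₀ - m‖²`.
  have hsq : ∫ x, (loss ψ x S - loss ψ x S₀) ^ 2 ∂ν ≤ C * (2 * D + 2 * D₀) := by
    have h1 : sqDist μ S S₀ ≤ ENNReal.ofReal (2 * D + 2 * D₀) := by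
      refine (sqDist_le_two_mul_add μ hS (measurable_condMean (κ := κ) hψ)).trans_eq ?_
      rw [sqDist_comm μ _ S₀, ENNReal.ofReal_add (by positivity) (by positivity),
        ENNReal.ofReal_mul zero_le_two, ENNReal.ofReal_mul zero_le_two, ENNReal.ofReal_toReal tS,
        ENNReal.ofReal_toReal tS₀, ENNReal.ofReal_ofNat]
    rw [integral_eq_lintegral_of_nonneg_ae (ae_of_all _ fun x => sq_nonneg _)
      (mh.pow_const 2).aestronglyMeasurable]
    refine ENNReal.toReal_le_of_le_ofReal (by positivity) (hvar.trans ?_)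
    rw [ENNReal.ofReal_mul hC.le]
    gcongr
  have h1 : 1 / (8 * C) * ∫ x, (loss ψ x S - loss ψ x S₀) ^ 2 ∂ν ≤ (D + D₀) / 4 := by
    refine (mul_le_mul_of_nonneg_left hsq (by positivity)).trans_eq ?_
    field_simp
    ring
  -- The variance term takes `(D + D₀)/4` from `D - D₀`, so a positive multiple of `D` survives.
  have h2 : 3 / 4 * D - 5 / 4 * D₀ ≤ 64 * C * R / n := by
    rw [le_div_iff₀ hn0]
    rw [one_div, inv_mul_le_iff₀ (by positivity)] at hdev
    have h3 : 3 / 4 * D - 5 / 4 * D₀ ≤ ∫ x, (offsetClip C (loss ψ x S - loss ψ x S₀) -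
            1 / (32 * C) * offsetClip C (loss ψ x S - loss ψ x S₀) ^ 2) ∂ν := by linarith
    have h4 := mul_le_mul_of_nonneg_right h3 hn0.le
    linarith
  have h5 : 256 / 3 * C * R / n = 4 / 3 * (64 * C * R / n) := by ring
  rw [h5]
  linarith

end JointRegression

theorem mainTheorem8 (C c : ℝ) (hC : 0 < C) (hc : 0 < c) :
    ∃ C₁ : ℝ, 0 < C₁ ∧
    ∀ (n : ℕ) (_ : 1 ≤ n) (DX DY : ℕ)
      -- the distribution `μ* = μ*_X μ*_{Y|X}`, carried by `M`
      (μX : Measure (EuclideanSpace ℝ (Fin DX))) (_ : IsProbabilityMeasure μX)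
      (κ : Kernel (EuclideanSpace ℝ (Fin DX)) (EuclideanSpace ℝ (Fin DY))) (_ : IsMarkovKernel κ)
      (M : Set (EuclideanSpace ℝ (Fin DX) × EuclideanSpace ℝ (Fin DY)))
      (_ : ∀ᵐ z ∂(μX.compProd κ), z ∈ M)
      -- the sample
      (Ω : Type*) (_ : MeasurableSpace Ω) (P : Measure Ω) (_ : IsProbabilityMeasure P)
      (Z : Fin n → Ω → EuclideanSpace ℝ (Fin DX) × EuclideanSpace ℝ (Fin DY))
      (_ : ∀ i, Measurable (Z i)) (_ : iIndepFun Z P) (_ : ∀ i, P.map (Z i) = μX.compProd κ)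
      -- the response functions `ψ_λ` and the class `𝒮`
      (Λ : Type*) (_ : Countable Λ) (ψ : Λ → EuclideanSpace ℝ (Fin DY) → ℝ)
      (_ : ∀ l, Measurable (ψ l))
      (_ : ∀ l, ∀ᵐ x ∂μX, Integrable (ψ l) (κ x))
      (_ : ∀ᵐ z ∂(μX.compProd κ), Summable fun l => ψ l z.2 ^ 2)
      (𝒮 : Set (Λ → EuclideanSpace ℝ (Fin DX) → ℝ))
      (_ : ∀ S ∈ 𝒮, ∀ l, Measurable (S l))
      -- (1) boundedness
      (_ : ∀ S ∈ 𝒮, ∀ z ∈ M,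
        ∑' l, ENNReal.ofReal (S l z.1 ^ 2 + |ψ l z.2 * S l z.1|) ≤ ENNReal.ofReal C)
      -- (2) the link between the second moment of the loss and the mean square
      (_ : ∀ S ∈ 𝒮, ∀ S' ∈ 𝒮,
        ∫⁻ z, ENNReal.ofReal ((JointRegression.loss ψ z S - JointRegression.loss ψ z S') ^ 2)
            ∂(μX.compProd κ)
          ≤ ENNReal.ofReal C * JointRegression.sqDist μX S S')
      -- (3) covering numbers
      (W T : ℝ) (_ : 1 < W) (_ : 1 < T)
      (_ : ∀ᵐ ω ∂P, ∀ ε : ℝ≥0, 0 < ε →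
        (ε : ℝ≥0∞) ≤ (⨆ S ∈ 𝒮, ⨆ S' ∈ 𝒮,
          ENNReal.ofReal (JointRegression.empDist ψ (fun i => Z i ω) S S')) →
        (JointRegression.empCoveringNumber ψ (fun i => Z i ω) 𝒮 ε : ℝ≥0∞)
          ≤ ENNReal.ofReal ((T / (ε : ℝ)) ^ W))
      -- the estimator, a measurable function of the data with values in `𝒮`
      (Shat : (Fin n → EuclideanSpace ℝ (Fin DX) × EuclideanSpace ℝ (Fin DY)) →
        Λ → EuclideanSpace ℝ (Fin DX) → ℝ)
      (_ : ∀ l, Measurable fun p : (Fin n → EuclideanSpace ℝ (Fin DX) ×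
        EuclideanSpace ℝ (Fin DY)) × EuclideanSpace ℝ (Fin DX) => Shat p.1 l p.2)
      (_ : ∀ z, Shat z ∈ 𝒮)
      (_ : ∀ᵐ ω ∂P,
        IsMinOn (JointRegression.empRisk ψ (fun i => Z i ω)) 𝒮 (Shat fun i => Z i ω)),
      ENNReal.ofReal (1 - (n : ℝ) ^ (-c)) ≤
        P {ω | JointRegression.sqDist μX (Shat fun i => Z i ω) (JointRegression.condMean κ ψ) ≤
          ENNReal.ofReal (C₁ * (W * (Real.log n + Real.log T) / n)) +
          ENNReal.ofReal C₁ *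
            ⨅ S ∈ 𝒮, JointRegression.sqDist μX S (JointRegression.condMean κ ψ)} := by
  set K : ℝ := 3 / (64 * C) + 9 / (4 * (32 * C) ^ 2) with hK
  have hK0 : 0 < K := by positivity
  -- Since `W L ≥ 1/2` and `log n ≤ W L` for `n ≥ 2`, the threshold `W L + K + c log n` is at most
  -- `(1 + 2K + c) W L`. The extra `10/3` below pays for `5/3` times the slack `1/n ≤ 2 W L / n`,
  -- and also dominates the factor `5/3` of the infimum.
  set A : ℝ := 256 / 3 * C * (1 + 2 * K + c) with hA
  have hA0 : 0 < A := by positivity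
  refine ⟨10 / 3 + A, by positivity, ?_⟩
  intro n hn DX DY μX _ κ _ M hM Ω _ P _ Z hZ hind hlaw Λ _ ψ hψ _ hψ2 𝒮 hS hbd hvar W T hW hT hcov
    Shat hShatm hShat hmin
  have hC₁ : (0 : ℝ) < 10 / 3 + A := by positivity
  set m := JointRegression.condMean κ ψ with hm
  set I := ⨅ S ∈ 𝒮, JointRegression.sqDist μX S m with hI
  set L : ℝ := Real.log n + Real.log T with hL
  by_cases hItop : I = ∞
  · rw [hItop]
    simp [ENNReal.mul_top, hC₁]
    positivity
  -- For `n = 1` the claimed probability is `1 - 1 = 0`.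
  obtain rfl | hn2 := hn.eq_or_lt
  · simp
  have hn2' : (2 : ℝ) ≤ n := by exact_mod_cast hn2
  have hn0 : (0 : ℝ) < n := by linarith
  have hlogn : Real.log 2 ≤ Real.log n := Real.log_le_log two_pos hn2'
  have hlogT : 0 < Real.log T := Real.log_pos hT
  have hlog2 : (1 : ℝ) / 2 < Real.log 2 := by linarith [Real.log_two_gt_d9]
  have hL0 : 0 < L := by linarith
  have hWL : 1 / 2 ≤ W * L := by nlinarith
  have hWL' : Real.log n ≤ W * L := by nlinarith
  -- The infimum need not be attained; a slack of `1/n` is of the order of the main term.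
  obtain ⟨S₀, hS₀, hS₀I⟩ : ∃ S₀ ∈ 𝒮,
      JointRegression.sqDist μX S₀ m < I + ENNReal.ofReal (1 / n) := by
    have : I < I + ENNReal.ofReal (1 / n) :=
      ENNReal.lt_add_right hItop (ENNReal.ofReal_pos.2 (by positivity)).ne'
    simpa only [hI, iInf_lt_iff, exists_prop] using this
  have hD₀top : JointRegression.sqDist μX S₀ m ≠ ∞ :=
    (hS₀I.trans (ENNReal.add_lt_top.2 ⟨lt_top_iff_ne_top.2 hItop, ENNReal.ofReal_lt_top⟩)).ne
  have hbnd {S : Λ → EuclideanSpace ℝ (Fin DX) → ℝ} (hSS : S ∈ 𝒮) : ∀ᵐ z ∂(μX.compProd κ),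
      ∑' l, ENNReal.ofReal (S l z.1 ^ 2 + |ψ l z.2 * S l z.1|) ≤ ENNReal.ofReal C := by
    filter_upwards [hM] with z hz using hbd S hSS z hz
  -- `m` is at finite distance from `S₀`, which is itself at finite distance from `0`.
  have hmtop : JointRegression.sqDist μX m 0 ≠ ∞ := by
    refine ((JointRegression.sqDist_le_two_mul_add μX
      (JointRegression.measurable_condMean hψ) (hS S₀ hS₀)).trans_lt ?_).ne
    have := (JointRegression.sqDist_zero_le μX (hS S₀ hS₀) (hbnd hS₀)).trans_lt
      ENNReal.ofReal_lt_top
    rw [JointRegression.sqDist_comm μX _ S₀]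
    finiteness
  have hZm : Measurable fun ω i => Z i ω := measurable_pi_lambda _ hZ
  have hZlaw : P.map (fun ω i => Z i ω) = Measure.pi fun _ => μX.compProd κ := by
    rw [(iIndepFun_iff_map_fun_eq_pi_map fun i => (hZ i).aemeasurable).1 hind]
    simp_rw [hlaw]
  have hbad := JointRegression.measure_offsetClip_deviation_le hC (by omega) (μX.compProd κ) P hZm
    hZlaw hψ hS₀ (hS S₀ hS₀) (by linarith) hT.le hcov hShatm hShat (c * Real.log n)
  have hexp : Real.exp (-(c * Real.log n)) = (n : ℝ) ^ (-c) := by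
    rw [Real.rpow_def_of_pos hn0]
    ring_nf
  rw [hexp] at hbad
  set good := {ω | JointRegression.sqDist μX (Shat fun i => Z i ω) m ≤
    ENNReal.ofReal ((10 / 3 + A) * (W * L / n)) + ENNReal.ofReal (10 / 3 + A) * I} with hgood
  have hsample {p : EuclideanSpace ℝ (Fin DX) × EuclideanSpace ℝ (Fin DY) → Prop}
      (hp : ∀ᵐ z ∂(μX.compProd κ), p z) : ∀ᵐ ω ∂P, ∀ i, p (Z i ω) :=
    ae_all_iff.2 fun i => ae_of_ae_map (hZ i).aemeasurable ((hlaw i).symm ▸ hp)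
  have hcomp : ∀ᵐ ω ∂P, ω ∈ good ∪ {ω | W * L + K + c * Real.log n ≤
      1 / (64 * C) * (n * ∫ x, (JointRegression.offsetClip C
          (JointRegression.loss ψ x (Shat fun i => Z i ω) - JointRegression.loss ψ x S₀) -
            1 / (32 * C) * JointRegression.offsetClip C
          (JointRegression.loss ψ x (Shat fun i => Z i ω) - JointRegression.loss ψ x S₀) ^ 2)
            ∂(μX.compProd κ) -
          ∑ i, (JointRegression.offsetClip C (JointRegression.loss ψ (Z i ω) (Shat fun i => Z i ω) -
              JointRegression.loss ψ (Z i ω) S₀) +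
            1 / (32 * C) * JointRegression.offsetClip C (JointRegression.loss ψ (Z i ω)
              (Shat fun i => Z i ω) - JointRegression.loss ψ (Z i ω) S₀) ^ 2))} := by
    filter_upwards [hmin, hsample hM, hsample hψ2] with ω hω hMω hψω
    refine or_iff_not_imp_right.2 fun hdev => ?_
    rw [Set.mem_ofPred_eq, not_le] at hdev
    have hSω := hShat fun i => Z i ω
    have hz (i : Fin n) := hbd _ hSω _ (hMω i)
    have hz₀ (i : Fin n) := hbd _ hS₀ _ (hMω i)
    have hfin := JointRegression.toReal_sqDist_le_of_deviation_le hC (by omega) hψ (hS _ hSω)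
      (hS _ hS₀) (hbnd hSω) (hbnd hS₀) (hvar _ hSω _ hS₀) hmtop hz hz₀
      (JointRegression.sum_loss_le_of_empRisk_le (by omega) hz hz₀ hψω (hω hS₀)) hdev.le
    have htop := (JointRegression.toReal_sqDist_condMean hψ (hS _ hSω) (hbnd hSω) hmtop).1
    have hD₀ : (JointRegression.sqDist μX S₀ m).toReal ≤ I.toReal + 1 / n := by
      refine (ENNReal.toReal_mono (by finiteness) hS₀I.le).trans_eq ?_
      rw [ENNReal.toReal_add hItop ENNReal.ofReal_ne_top, ENNReal.toReal_ofReal (by positivity)]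
    have hR : 256 / 3 * C * (W * L + K + c * Real.log n) / n ≤ A * (W * L / n) := by
      rw [hA, ← mul_div_assoc, mul_assoc (256 / 3 * C)]
      gcongr
      nlinarith
    have h1n : (1 : ℝ) / n ≤ 2 * (W * L / n) := by
      rw [← mul_div_assoc]
      gcongr
      linarith
    have hIn : 0 ≤ I.toReal := ENNReal.toReal_nonneg
    have hmain : (JointRegression.sqDist μX (Shat fun i => Z i ω) m).toReal ≤
        (10 / 3 + A) * (W * L / n) + (10 / 3 + A) * I.toReal := by
      nlinarith
    change JointRegression.sqDist μX (Shat fun i => Z i ω) m ≤ _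
    rw [← ENNReal.ofReal_toReal htop, ← ENNReal.ofReal_toReal hItop,
      ← ENNReal.ofReal_mul hC₁.le, ← ENNReal.ofReal_add (by positivity) (by positivity)]
    exact ENNReal.ofReal_le_ofReal hmain
  -- Subadditivity of `P` on the union of the good and the bad event is used in place of
  -- complements, so the good event need not be measurable.
  have htot := (measure_univ (μ := P)).symm.le.trans
    ((measure_mono_ae (hcomp.mono fun _ h _ => h)).trans (measure_union_le _ _))
  rw [ENNReal.ofReal_sub _ (by positivity), ENNReal.ofReal_one]
  exact tsub_le_iff_right.2 (htot.trans (add_le_add le_rfl hbad))
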